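/- Let $K$ be a field of characteristic $0$ with algebraic closure $\overline{K}$, let $E/K$ be an elliptic curve, let $\ell$ be a prime and let $m$ be a positive integer such that $\ell^m \ge 3$. Suppose that $E(K)$ contains a subgroup isomorphic to $(\mathbb{Z}/\ell^m\mathbb{Z})^2$. For an integer $k \ge 0$, put $$\mathscr{T}_k = \{P \in E(\overline{K})[\ell^\infty] : \ell^k P \in E(K)\},$$ where $[\ell^\infty]$ denotes the subgroup of elements whose order is a power of $\ell$, and let $K(\mathscr{T}_k) \subseteq \overline{K}$ be the field generated over $K$ by the coordinates of the affine points in $\mathscr{T}_k$. Then for every $k \ge 0$, $$E(K(\mathscr{T}_k))[\ell^\infty] = \mathscr{T}_k.$$ -/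

import Mathlib

noncomputable section

namespace EllTorsion

variable {K : Type*} [Field K] (E : WeierstrassCurve K)
variable (Kbar : Type*) [Field Kbar] [Algebra K Kbar] [DecidableEq Kbar]

/-- The group `E(Kbar)` of points of `E` over an extension field `Kbar` of `K`. -/
abbrev GeomPoint : Type _ := (E.baseChange Kbar).toAffine.Point

open scoped Classical in
/-- The group `E(F)` of `F`-rational points, for a field `F` with `K ⊆ F ⊆ Kbar`, viewed as a
subgroup of `E(Kbar)`: the image of `E(F)` under the natural inclusion `E(F) → E(Kbar)`. -/
def rationalPoints (F : Type*) [Field F] [Algebra K F] [Algebra F Kbar] [IsScalarTower K F Kbar] :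
    AddSubgroup (GeomPoint E Kbar) :=
  (WeierstrassCurve.Affine.Point.map (W' := E.toAffine) (IsScalarTower.toAlgHom K F Kbar)).range

/-- `E(F)[ℓ^∞]`: the points of `E(F)` whose order is a power of `ℓ` (for a prime `ℓ`). -/
def rationalPrimary (ℓ : ℕ) (F : Type*) [Field F] [Algebra K F] [Algebra F Kbar]
    [IsScalarTower K F Kbar] : AddSubgroup (GeomPoint E Kbar) :=
  rationalPoints E Kbar F ⊓ AddCommGroup.primaryComponent (GeomPoint E Kbar) ℓ

/-- `𝒯_k`: the points `P` of `E(Kbar)[ℓ^∞]` such that `ℓ^k P ∈ E(K)`. -/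
def divisionSubgroup (ℓ : ℕ) (k : ℕ) : AddSubgroup (GeomPoint E Kbar) :=
  AddCommGroup.primaryComponent (GeomPoint E Kbar) ℓ ⊓
    (rationalPoints E Kbar K).comap (nsmulAddMonoidHom (ℓ ^ k))

variable {E Kbar} in
/-- The field of definition `K(S)` of a set `S` of points of `E(Kbar)`: the extension of `K` inside
`Kbar` generated by the coordinates of the affine points in `S`. -/
def fieldOfDefinition (S : Set (GeomPoint E Kbar)) : IntermediateField K Kbar :=
  IntermediateField.adjoin K
    {z : Kbar | ∃ (x y : Kbar) (h : (E.baseChange Kbar).toAffine.Nonsingular x y),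
      WeierstrassCurve.Affine.Point.some x y h ∈ S ∧ (z = x ∨ z = y)}

end EllTorsion

end

/-! Let σ be a K-automorphism of Kbar and δ = σ - 1 on E(Kbar). If E[ℓ^m] is rational, δ kills it,
and ℓ^m ≥ 3 then forces σ^(ℓ^k) a = a + ℓ^k δa whenever ℓ^(k+1) δa = 0 (`iterate_pow_apply`). On 𝒯_k
the term ℓ^k δa vanishes, so σ^(ℓ^k) fixes K(𝒯_k). For Q rational over that field with ℓ^(k+1) Q ∈
E(K), this gives ℓ^k δQ = 0; as σ is arbitrary, ℓ^k Q ∈ E(K). Descent on the power of ℓ finishes.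

Rationality of E[ℓ^m] is a count: the given subgroup already has ℓ^(2m) elements, and #E[ℓ] ≤ ℓ^2
because abscissae of ℓ-torsion points are roots of a division polynomial. For odd ℓ that vanishing
comes from `divSeq`, built from the x(nP) and identified with `normEDS`. -/

namespace WeierstrassCurve.Affine

/-! ### Abscissae of sums and differences -/

variable {F : Type*} [Field F] {W : WeierstrassCurve.Affine F}

/-- The `x`-coordinate of a point, with value `0` at infinity. -/
def Point.xCoord : W.Point → F
  | .zero => 0
  | .some x _ _ => x

@[simp]
lemma Point.xCoord_some {x y : F} (h : W.Nonsingular x y) : (Point.some x y h).xCoord = x := rfl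

lemma Point.xCoord_eq_iff {P Q : W.Point} (hP : P ≠ 0) (hQ : Q ≠ 0) :
    P.xCoord = Q.xCoord ↔ P = Q ∨ P = -Q := by
  rcases P with _ | ⟨x₁, y₁, h₁⟩
  · exact absurd rfl hP
  rcases Q with _ | ⟨x₂, y₂, h₂⟩
  · exact absurd rfl hQ
  exact Point.X_eq_iff

variable [DecidableEq F]

/-- The ordinates cancel modulo the two Weierstrass equations, so all later work involves abscissae
only. -/
lemma Point.xCoord_add_sub {P Q : W.Point} (hP : P ≠ 0) (hQ : Q ≠ 0)
    (h : P.xCoord ≠ Q.xCoord) :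
    ((P + Q).xCoord + (P - Q).xCoord) * (P.xCoord - Q.xCoord) ^ 2 =
        2 * (P.xCoord * Q.xCoord) * (P.xCoord + Q.xCoord) + W.b₂ * (P.xCoord * Q.xCoord) +
          W.b₄ * (P.xCoord + Q.xCoord) + W.b₆ ∧
      (P + Q).xCoord * (P - Q).xCoord * (P.xCoord - Q.xCoord) ^ 2 =
        (P.xCoord * Q.xCoord) ^ 2 - W.b₄ * (P.xCoord * Q.xCoord) -
          W.b₆ * (P.xCoord + Q.xCoord) - W.b₈ := by
  rcases P with _ | ⟨x₁, y₁, h₁⟩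
  · exact absurd rfl hP
  rcases Q with _ | ⟨x₂, y₂, h₂⟩
  · exact absurd rfl hQ
  simp only [Point.xCoord_some] at h
  rw [sub_eq_add_neg, Point.neg_some, Point.add_of_X_ne h, Point.add_of_X_ne h]
  simp only [Point.xCoord_some, slope_of_X_ne h, addX, negY, b₂, b₄, b₆, b₈]
  have e₁ := (W.equation_iff x₁ y₁).mp h₁.1
  have e₂ := (W.equation_iff x₂ y₂).mp h₂.1
  have hd : x₁ - x₂ ≠ 0 := sub_ne_zero.mpr h
  constructor
  · field_simp
    linear_combination (2 : F) * e₁ + 2 * e₂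
  · field_simp
    grind only

lemma Point.xCoord_two_nsmul {x y : F} (h : W.Nonsingular x y) (hy : y ≠ W.negY x y) :
    (2 • Point.some x y h).xCoord * (2 * y + W.a₁ * x + W.a₃) ^ 2 =
      x ^ 4 - W.b₄ * x ^ 2 - 2 * W.b₆ * x - W.b₈ := by
  rw [two_nsmul, Point.add_self_of_Y_ne hy, Point.xCoord_some, slope_of_Y_ne rfl hy]
  have e := (W.equation_iff x y).mp h.1
  have hd : y - W.negY x y ≠ 0 := sub_ne_zero.mpr hy
  obtain ⟨D, hD⟩ : ∃ D, D = 2 * y + W.a₁ * x + W.a₃ := ⟨_, rfl⟩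
  have hD' : y - W.negY x y = D := by rw [negY, hD]; ring
  rw [hD'] at hd ⊢
  rw [← hD]
  simp only [addX, b₄, b₆, b₈]
  field_simp
  clear hD' hy h
  subst hD
  grind only

/-- The biquadratic relation between `x(P ± Q)` and a third abscissa `x(R)` is symmetric in
`P` and `R`. -/
lemma Point.xCoord_three_points {P Q R : W.Point} (hP : P ≠ 0) (hQ : Q ≠ 0) (hR : R ≠ 0)
    (hPQ : Q.xCoord ≠ P.xCoord) (hQR : R.xCoord ≠ Q.xCoord) :
    ((Q + P).xCoord - R.xCoord) * ((Q - P).xCoord - R.xCoord) * (P.xCoord - Q.xCoord) ^ 2 =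
      (P.xCoord - (R + Q).xCoord) * (P.xCoord - (R - Q).xCoord) * (Q.xCoord - R.xCoord) ^ 2 := by
  obtain ⟨s₁, p₁⟩ := Point.xCoord_add_sub hQ hP hPQ
  obtain ⟨s₂, p₂⟩ := Point.xCoord_add_sub hR hQ hQR
  -- Both sides equal one polynomial symmetric in all three abscissae.
  linear_combination p₁ - R.xCoord * s₁ - p₂ + P.xCoord * s₂

/-! ### The elliptic divisibility sequence of a point -/

/-- The sequence `x(nP)`. -/
def multX (P : W.Point) (n : ℕ) : F := (n • P).xCoord

/-- The values at `P` of the division polynomials, computed from the sequence `x(nP)` and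
the value `b` of the `2`-division polynomial. -/
def divSeq (b : F) (P : W.Point) : ℕ → F
  | 0 => 0
  | 1 => 1
  | 2 => b
  -- Solves ψ_{j+1} ψ_{j-1} = (x(P) - x(jP)) ψ_j^2 at j = n + 2; meaningful only up to the first
  -- zero.
  | n + 3 => (multX P 1 - multX P (n + 2)) * divSeq b P (n + 2) ^ 2 / divSeq b P (n + 1)

section Torsion

variable {P : W.Point} {r : ℕ}

lemma multX_ne (hP : ∀ n, 0 < n → n < r → n • P ≠ 0) {m n : ℕ} (hn : 0 < n) (hnm : n < m)
    (h : m + n < r) : multX P m ≠ multX P n := by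
  intro heq
  rcases (Point.xCoord_eq_iff (hP m (by omega) (by omega)) (hP n hn (by omega))).mp heq with e | e
  · apply hP (m - n) (by omega) (by omega)
    rw [sub_nsmul _ hnm.le, e, add_neg_cancel]
  · apply hP (m + n) (by omega) h
    rw [add_nsmul, e, neg_add_cancel]

lemma multX_add_sub (hP : ∀ n, 0 < n → n < r → n • P ≠ 0) {m n : ℕ} (hn : 0 < n) (hnm : n < m)
    (h : m + n < r) :
    (multX P (m + n) + multX P (m - n)) * (multX P m - multX P n) ^ 2 =
        2 * (multX P m * multX P n) * (multX P m + multX P n) +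
          W.b₂ * (multX P m * multX P n) + W.b₄ * (multX P m + multX P n) + W.b₆ ∧
      multX P (m + n) * multX P (m - n) * (multX P m - multX P n) ^ 2 =
        (multX P m * multX P n) ^ 2 - W.b₄ * (multX P m * multX P n) -
          W.b₆ * (multX P m + multX P n) - W.b₈ := by
  have := Point.xCoord_add_sub (hP m (by omega) (by omega)) (hP n hn (by omega))
    (multX_ne hP hn hnm h)
  rwa [← add_nsmul, sub_eq_add_neg, ← sub_nsmul _ hnm.le] at this

lemma multX_three (hP : ∀ n, 0 < n → n < r → n • P ≠ 0) {m n : ℕ} (hn : 1 < n) (hnm : n < m)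
    (h : m + n < r) :
    (multX P (n + 1) - multX P m) * (multX P (n - 1) - multX P m) *
        (multX P 1 - multX P n) ^ 2 =
      (multX P 1 - multX P (m + n)) * (multX P 1 - multX P (m - n)) *
        (multX P n - multX P m) ^ 2 := by
  have := Point.xCoord_three_points (hP 1 one_pos (by omega)) (hP n (by omega) (by omega))
    (hP m (by omega) (by omega)) (multX_ne hP one_pos hn (by omega))
    (multX_ne hP (by omega) hnm (by omega))
  rwa [← add_nsmul, ← add_nsmul, sub_eq_add_neg (n • P), sub_eq_add_neg (m • P), ← sub_nsmul _ hn.le,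
    ← sub_nsmul _ hnm.le] at this

lemma multX_last (hP : r • P = 0) (hr : 0 < r) : multX P (r - 1) = multX P 1 := by
  have h : (r - 1) • P = -(1 • P) := by
    rw [sub_nsmul _ hr, hP, zero_add]
  rcases P with _ | ⟨x, y, hxy⟩
  · simp [multX, ← Point.zero_def]
  · rw [multX, multX, h, one_nsmul, Point.neg_some, Point.xCoord_some, Point.xCoord_some]

variable {b : F}

lemma divSeq_ne_zero (hb : b ≠ 0) (hP : ∀ n, 0 < n → n < r → n • P ≠ 0) {n : ℕ} (hn : 0 < n)
    (hnr : n < r) : divSeq b P n ≠ 0 := by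
  induction n using Nat.strong_induction_on with
  | _ n ih =>
    match n, hn with
    | 1, _ => simp [divSeq]
    | 2, _ => simpa [divSeq] using hb
    | n + 3, _ =>
      rw [divSeq]
      have h₁ := ih (n + 2) (by omega) (by omega) (by omega)
      have h₂ := ih (n + 1) (by omega) (by omega) (by omega)
      have h₃ := sub_ne_zero.mpr
        (multX_ne hP one_pos (show 1 < n + 2 by omega) (by omega)).symm
      positivity

lemma divSeq_mul_pred (hb : b ≠ 0) (hP : ∀ n, 0 < n → n < r → n • P ≠ 0) {n : ℕ} (hn : 0 < n)
    (hnr : n < r) :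
    divSeq b P (n + 1) * divSeq b P (n - 1) =
      (multX P 1 - multX P n) * divSeq b P n ^ 2 := by
  match n, hn with
  | 1, _ => simp [divSeq]
  | n + 2, _ =>
    rw [divSeq, show n + 2 - 1 = n + 1 by omega]
    exact div_mul_cancel₀ _ (divSeq_ne_zero hb hP (by omega) (by omega))

/-- Since (r - 1)P = -P has the abscissa of P, the numerator vanishes. -/
lemma divSeq_last (hP : r • P = 0) (hr : 3 ≤ r) : divSeq b P r = 0 := by
  obtain ⟨n, rfl⟩ : ∃ n, r = n + 3 := ⟨r - 3, by omega⟩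
  have := multX_last hP (by omega)
  rw [show n + 3 - 1 = n + 2 by omega] at this
  rw [divSeq, this, sub_self, zero_mul, zero_div]

/-- The case n = 2 of `divSeq_mul_of_lt`, which needs the duplication formula `hd`: `multX_three` at
n = 1 would involve 0 • P. -/
lemma divSeq_somos (hb : b ≠ 0) (hP : ∀ n, 0 < n → n < r → n • P ≠ 0)
    (hd : (multX P 1 - multX P 2) * b ^ 2 = 3 * multX P 1 ^ 4 + W.b₂ * multX P 1 ^ 3 +
      3 * W.b₄ * multX P 1 ^ 2 + 3 * W.b₆ * multX P 1 + W.b₈)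
    (hb2 : b ^ 2 = 4 * multX P 1 ^ 3 + W.b₂ * multX P 1 ^ 2 + 2 * W.b₄ * multX P 1 + W.b₆)
    {m : ℕ} (hm : 2 < m) (h : m + 2 ≤ r) :
    (multX P 2 - multX P m) * divSeq b P m ^ 2 * b ^ 2 =
      divSeq b P (m + 2) * divSeq b P (m - 2) := by
  have e₁ := divSeq_mul_pred hb hP (n := m) (by omega) (by omega)
  have e₂ := divSeq_mul_pred hb hP (n := m + 1) (by omega) (by omega)
  have e₃ := divSeq_mul_pred hb hP (n := m - 1) (by omega) (by omega)
  rw [show m + 1 - 1 = m by omega] at e₂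
  rw [show m - 1 + 1 = m by omega, show m - 1 - 1 = m - 2 by omega] at e₃
  have hne := divSeq_ne_zero hb hP (n := m) (by omega) (by omega)
  obtain ⟨s, p⟩ := multX_add_sub hP (m := m) (n := 1) one_pos (by omega) (by omega)
  have key : (multX P 1 - multX P (m + 1)) * (multX P 1 - multX P (m - 1)) *
      (multX P 1 - multX P m) ^ 2 = (multX P 2 - multX P m) * b ^ 2 := by
    linear_combination p - multX P 1 * s + hd - (multX P 1 - multX P m) * hb2
  apply mul_right_cancel₀ (pow_ne_zero 2 hne)
  calc _ = ((multX P 2 - multX P m) * b ^ 2) * divSeq b P m ^ 2 * divSeq b P m ^ 2 := by ring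
    _ = (multX P 1 - multX P (m + 1)) * (multX P 1 - multX P (m - 1)) *
        ((multX P 1 - multX P m) * divSeq b P m ^ 2) ^ 2 := by rw [← key]; ring
    _ = ((multX P 1 - multX P (m + 1)) * divSeq b P (m + 1) ^ 2) *
        ((multX P 1 - multX P (m - 1)) * divSeq b P (m - 1) ^ 2) := by rw [← e₁]; ring
    _ = _ := by rw [← e₂, ← e₃]; ring

/-- Induction on n: by `multX_three`, the relation for n + 3 times that for n + 1 reduces to the
square of that for n + 2. -/
lemma divSeq_mul_of_lt (hb : b ≠ 0) (hP : ∀ n, 0 < n → n < r → n • P ≠ 0)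
    (hd : (multX P 1 - multX P 2) * b ^ 2 = 3 * multX P 1 ^ 4 + W.b₂ * multX P 1 ^ 3 +
      3 * W.b₄ * multX P 1 ^ 2 + 3 * W.b₆ * multX P 1 + W.b₈)
    (hb2 : b ^ 2 = 4 * multX P 1 ^ 3 + W.b₂ * multX P 1 ^ 2 + 2 * W.b₄ * multX P 1 + W.b₆)
    {m n : ℕ} (hn : 0 < n) (hnm : n < m) (h : m + n ≤ r) :
    (multX P n - multX P m) * divSeq b P m ^ 2 * divSeq b P n ^ 2 =
      divSeq b P (m + n) * divSeq b P (m - n) := by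
  induction n using Nat.strong_induction_on with
  | _ n ih =>
    match n, hn with
    | 1, _ =>
      rw [divSeq_mul_pred hb hP (by omega) (by omega)]
      simp [divSeq]
    | 2, _ => exact divSeq_somos hb hP hd hb2 hnm h
    | n + 3, _ =>
      have i₁ := ih (n + 2) (by omega) (by omega) (by omega) (by omega)
      have i₂ := ih (n + 1) (by omega) (by omega) (by omega) (by omega)
      have t := multX_three hP (m := m) (n := n + 2) (by omega) (by omega) (by omega)
      have e₁ := divSeq_mul_pred hb hP (n := m + (n + 2)) (by omega) (by omega)
      have e₂ := divSeq_mul_pred hb hP (n := m - (n + 2)) (by omega) (by omega)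
      have e₃ := divSeq_mul_pred hb hP (n := n + 2) (by omega) (by omega)
      have n₁ := divSeq_ne_zero hb hP (n := m) (by omega) (by omega)
      have n₂ := divSeq_ne_zero hb hP (n := n + 1) (by omega) (by omega)
      have n₃ := divSeq_ne_zero hb hP (n := n + 2) (by omega) (by omega)
      have n₄ := sub_ne_zero.mpr
        (multX_ne hP (m := m) (n := n + 1) (by omega) (by omega) (by omega)).symm
      rw [show m + (n + 2) + 1 = m + (n + 3) by omega,
        show m + (n + 2) - 1 = m + (n + 1) by omega] at e₁
      rw [show m - (n + 2) + 1 = m - (n + 1) by omega,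
        show m - (n + 2) - 1 = m - (n + 3) by omega] at e₂
      rw [show n + 2 + 1 = n + 3 by omega, show n + 2 - 1 = n + 1 by omega] at e₃ t
      have hne : (multX P (n + 1) - multX P m) * divSeq b P m ^ 2 * divSeq b P (n + 1) ^ 2 ≠ 0 := by
        positivity
      apply mul_right_cancel₀ hne
      generalize multX P (n + 1) - multX P m = u at *
      generalize multX P (n + 3) - multX P m = v at *
      generalize multX P (n + 2) - multX P m = w at *
      generalize multX P 1 - multX P (n + 2) = f at *
      calc _ = v * u * divSeq b P m ^ 4 * (divSeq b P (n + 3) * divSeq b P (n + 1)) ^ 2 := by ring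
        _ = (v * u * f ^ 2) * divSeq b P m ^ 4 * divSeq b P (n + 2) ^ 4 := by rw [e₃]; ring
        _ = (multX P 1 - multX P (m + (n + 2))) * (multX P 1 - multX P (m - (n + 2))) *
            (w * divSeq b P m ^ 2 * divSeq b P (n + 2) ^ 2) ^ 2 := by rw [t]; ring
        _ = ((multX P 1 - multX P (m + (n + 2))) * divSeq b P (m + (n + 2)) ^ 2) *
            ((multX P 1 - multX P (m - (n + 2))) * divSeq b P (m - (n + 2)) ^ 2) := by
          rw [i₁]; ring
        _ = (divSeq b P (m + (n + 3)) * divSeq b P (m - (n + 3))) *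
            (divSeq b P (m + (n + 1)) * divSeq b P (m - (n + 1))) := by rw [← e₁, ← e₂]; ring
        _ = _ := by rw [i₂]

lemma divSeq_eq_normEDS (hb : b ≠ 0) (hP : ∀ n, 0 < n → n < r → n • P ≠ 0)
    (hd : (multX P 1 - multX P 2) * b ^ 2 = W.Ψ₃.eval (multX P 1))
    (hb2 : b ^ 2 = W.Ψ₂Sq.eval (multX P 1)) {n : ℕ} (hn : n ≤ r) :
    divSeq b P n = normEDS b (W.Ψ₃.eval (multX P 1)) (W.preΨ₄.eval (multX P 1)) n := by
  have hd' : (multX P 1 - multX P 2) * b ^ 2 = 3 * multX P 1 ^ 4 + W.b₂ * multX P 1 ^ 3 +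
      3 * W.b₄ * multX P 1 ^ 2 + 3 * W.b₆ * multX P 1 + W.b₈ := by
    rw [hd]; simp [Ψ₃]
  have hb2' : b ^ 2 = 4 * multX P 1 ^ 3 + W.b₂ * multX P 1 ^ 2 + 2 * W.b₄ * multX P 1 + W.b₆ := by
    rw [hb2]; simp [Ψ₂Sq]
  induction n using normEDSRec' with
  | zero => simp [divSeq]
  | one => simp [divSeq]
  | two => simp [divSeq]
  | three => simp [divSeq, ← hd]
  | four =>
    have e₂ := divSeq_mul_pred hb hP (n := 3) (by omega) (by omega)
    have h₃ : divSeq b P 3 = (multX P 1 - multX P 2) * b ^ 2 := by simp [divSeq]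
    obtain ⟨s, -⟩ := multX_add_sub hP (m := 2) (n := 1) one_pos (by omega) (by omega)
    simp only [show 3 + 1 = 4 from rfl, show 2 + 1 = 3 from rfl, show 3 - 1 = 2 from rfl,
      show 2 - 1 = 1 from rfl, h₃] at e₂ s
    simp only [Nat.cast_ofNat, normEDS_four]
    apply mul_right_cancel₀ hb
    rw [show divSeq b P 4 * b = divSeq b P 4 * divSeq b P 2 by simp [divSeq], e₂, mul_assoc,
      ← sq, hb2']
    simp only [preΨ₄, Polynomial.eval_add, Polynomial.eval_mul, Polynomial.eval_ofNat,
      Polynomial.eval_pow, Polynomial.eval_X, Polynomial.eval_C]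
    rw [hb2'] at hd'
    generalize multX P 1 = x at *
    generalize multX P 2 = x₂ at *
    generalize multX P 3 = x₃ at *
    obtain ⟨D, hD⟩ : ∃ D, D = 4 * x ^ 3 + W.b₂ * x ^ 2 + 2 * W.b₄ * x + W.b₆ := ⟨_, rfl⟩
    rw [← hD] at hd' ⊢
    linear_combination -D ^ 2 * s + (6 * x ^ 2 + W.b₂ * x + W.b₄) * D * hd' -
      x ^ 2 * D * W.b_relation -
      D * (4 * x ^ 3 + W.b₂ * x ^ 2 + 2 * W.b₄ * x + W.b₆) * hD
  | even m ih =>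
    have h₁ := ih (m + 1) (by omega) (by omega)
    have h₂ := ih (m + 2) (by omega) (by omega)
    have h₃ := ih (m + 3) (by omega) (by omega)
    have h₄ := ih (m + 4) (by omega) (by omega)
    have h₅ := ih (m + 5) (by omega) (by omega)
    -- The index sum is the target 2(m + 3) and the difference is 2; `f₁` and `f₂` then eliminate
    -- the abscissae.
    have e := divSeq_mul_of_lt hb hP hd' hb2' (m := m + 4) (n := m + 2) (by omega) (by omega)
      (by omega)
    have f₁ := divSeq_mul_pred hb hP (n := m + 4) (by omega) (by omega)
    have f₂ := divSeq_mul_pred hb hP (n := m + 2) (by omega) (by omega)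
    rw [show m + 4 + (m + 2) = 2 * (m + 3) by omega, show m + 4 - (m + 2) = 2 by omega] at e
    rw [show m + 4 + 1 = m + 5 by omega, show m + 4 - 1 = m + 3 by omega] at f₁
    rw [show m + 2 + 1 = m + 3 by omega, show m + 2 - 1 = m + 1 by omega] at f₂
    apply mul_right_cancel₀ hb
    have := normEDS_even b (W.Ψ₃.eval (multX P 1)) (W.preΨ₄.eval (multX P 1)) ((m + 3 : ℕ) : ℤ)
    rw [show ((m + 3 : ℕ) : ℤ) - 1 = ((m + 2 : ℕ) : ℤ) by push_cast; ring,
      show ((m + 3 : ℕ) : ℤ) + 2 = ((m + 5 : ℕ) : ℤ) by push_cast; ring,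
      show ((m + 3 : ℕ) : ℤ) - 2 = ((m + 1 : ℕ) : ℤ) by push_cast; ring,
      show ((m + 3 : ℕ) : ℤ) + 1 = ((m + 4 : ℕ) : ℤ) by push_cast; ring,
      ← h₁, ← h₂, ← h₃, ← h₄, ← h₅] at this
    rw [Nat.cast_mul, Nat.cast_ofNat, this]
    have hb' : divSeq b P 2 = b := by simp [divSeq]
    rw [hb'] at e
    linear_combination -e + divSeq b P (m + 4) ^ 2 * f₂ - divSeq b P (m + 2) ^ 2 * f₁
  | odd m ih =>
    have h₁ := ih (m + 1) (by omega) (by omega)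
    have h₂ := ih (m + 2) (by omega) (by omega)
    have h₃ := ih (m + 3) (by omega) (by omega)
    have h₄ := ih (m + 4) (by omega) (by omega)
    have e := divSeq_mul_of_lt hb hP hd' hb2' (m := m + 3) (n := m + 2) (by omega) (by omega)
      (by omega)
    have f₁ := divSeq_mul_pred hb hP (n := m + 3) (by omega) (by omega)
    have f₂ := divSeq_mul_pred hb hP (n := m + 2) (by omega) (by omega)
    rw [show m + 3 + (m + 2) = 2 * (m + 2) + 1 by omega, show m + 3 - (m + 2) = 1 by omega] at e
    rw [show m + 3 + 1 = m + 4 by omega, show m + 3 - 1 = m + 2 by omega] at f₁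
    rw [show m + 2 + 1 = m + 3 by omega, show m + 2 - 1 = m + 1 by omega] at f₂
    have := normEDS_odd b (W.Ψ₃.eval (multX P 1)) (W.preΨ₄.eval (multX P 1)) ((m + 2 : ℕ) : ℤ)
    rw [show ((m + 2 : ℕ) : ℤ) - 1 = ((m + 1 : ℕ) : ℤ) by push_cast; ring,
      show ((m + 2 : ℕ) : ℤ) + 2 = ((m + 4 : ℕ) : ℤ) by push_cast; ring,
      show ((m + 2 : ℕ) : ℤ) + 1 = ((m + 3 : ℕ) : ℤ) by push_cast; ring,
      ← h₁, ← h₂, ← h₃, ← h₄] at this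
    rw [Nat.cast_add, Nat.cast_mul, Nat.cast_ofNat, Nat.cast_one, this]
    have hb' : divSeq b P 1 = 1 := by simp [divSeq]
    rw [hb'] at e
    linear_combination -e + divSeq b P (m + 3) ^ 2 * f₂ - divSeq b P (m + 2) ^ 2 * f₁

end Torsion

/-! ### Counting torsion by division polynomials -/

lemma Point.negY_ne_of_two_nsmul_ne_zero {x y : F} {h : W.Nonsingular x y}
    (h₂ : 2 • Point.some x y h ≠ 0) : y ≠ W.negY x y := by
  intro hy
  exact h₂ (by rw [two_nsmul, Point.add_self_of_Y_eq hy])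

omit [DecidableEq F] in
lemma eval_Ψ₂Sq_eq {x y : F} (h : W.Equation x y) :
    W.Ψ₂Sq.eval x = (2 * y + W.a₁ * x + W.a₃) ^ 2 := by
  have e := (W.equation_iff x y).mp h
  simp only [Ψ₂Sq, b₂, b₄, b₆, Polynomial.eval_add, Polynomial.eval_mul, Polynomial.eval_C,
    Polynomial.eval_pow, Polynomial.eval_X]
  linear_combination -4 * e

lemma eval_preΨ'_eq_zero {x y : F} {h : W.Nonsingular x y} {r : ℕ} (hr : 3 ≤ r) (hodd : ¬ Even r)
    (hP : ∀ n, 0 < n → n < r → n • Point.some x y h ≠ 0) (h0 : r • Point.some x y h = 0) :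
    (W.preΨ' r).eval x = 0 := by
  have hy := Point.negY_ne_of_two_nsmul_ne_zero (hP 2 two_pos (by omega))
  have hb : 2 * y + W.a₁ * x + W.a₃ ≠ 0 := by
    intro h0; apply hy; rw [negY]; linear_combination h0
  have hX : multX (Point.some x y h) 1 = x := by simp [multX]
  have hb2 := (eval_Ψ₂Sq_eq h.1).symm
  have hd : (x - multX (Point.some x y h) 2) * (2 * y + W.a₁ * x + W.a₃) ^ 2 =
      W.Ψ₃.eval x := by
    have := Point.xCoord_two_nsmul h hy
    simp only [Ψ₃, Polynomial.eval_add, Polynomial.eval_mul, Polynomial.eval_C,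
      Polynomial.eval_ofNat, Polynomial.eval_pow, Polynomial.eval_X]
    rw [sub_mul, multX, this, hb2]
    simp only [Ψ₂Sq, Polynomial.eval_add, Polynomial.eval_mul, Polynomial.eval_C,
      Polynomial.eval_pow, Polynomial.eval_X]
    ring
  have key := divSeq_eq_normEDS hb hP (by rwa [hX]) (by rwa [hX]) le_rfl
  -- For odd r, `normEDS` carries no extra factor b, so it is a polynomial in x alone.
  rw [divSeq_last h0 hr, hX, normEDS_ofNat, if_neg hodd, mul_one] at key
  have := map_preNormEDS' (Polynomial.evalRingHom x) (W.Ψ₂Sq ^ 2) W.Ψ₃ W.preΨ₄ r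
  simp only [Polynomial.coe_evalRingHom, Polynomial.eval_pow, ← hb2, ← pow_mul] at this
  rw [preΨ', this]
  exact key.symm

open Finset in
/-- The `ℓ`-torsion of a Weierstrass curve over a field in which the prime `ℓ` is nonzero has at
most `ℓ ^ 2` elements. -/
lemma card_le_of_prime_nsmul_eq_zero {ℓ : ℕ} (hℓ : ℓ.Prime) (hF : (ℓ : F) ≠ 0)
    (s : Finset W.Point) (hs : ∀ P ∈ s, ℓ • P = 0) : #s ≤ ℓ ^ 2 := by
  classical
  have horder {P : W.Point} (hP : P ≠ 0) (h : ℓ • P = 0) (n : ℕ) (hn : 0 < n) (hnℓ : n < ℓ) :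
      n • P ≠ 0 := by
    intro h'
    have h'' := addOrderOf_dvd_iff_nsmul_eq_zero.mpr h'
    have : Fact ℓ.Prime := ⟨hℓ⟩
    rw [addOrderOf_eq_prime h hP] at h''
    exact absurd (Nat.le_of_dvd hn h'') (by omega)
  suffices #(s.erase 0) ≤ ℓ ^ 2 - 1 by
    have h₁ := Finset.pred_card_le_card_erase (s := s) (a := 0)
    have := Nat.pow_pos (n := 2) hℓ.pos
    omega
  have hfib {P Q : W.Point} (hP : P ∈ s.erase 0) (hQ : Q ∈ s.erase 0)
      (h : P.xCoord = Q.xCoord) : P = Q ∨ P = -Q :=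
    (Point.xCoord_eq_iff (Finset.ne_of_mem_erase hP) (Finset.ne_of_mem_erase hQ)).mp h
  rcases hℓ.eq_two_or_odd' with rfl | hodd
  -- For ℓ = 2, P = -P, so abscissae are injective with at most three values.
  · have hinj : Set.InjOn Point.xCoord (s.erase 0 : Set W.Point) := by
      intro P hP Q hQ h
      rcases hfib hP hQ h with e | e
      · exact e
      · have := hs Q (Finset.mem_of_mem_erase hQ)
        rw [e, neg_eq_iff_add_eq_zero, ← two_nsmul, this]
    have h4 : (4 : F) ≠ 0 := by
      have : (4 : F) = ((2 : ℕ) : F) ^ 2 := by norm_num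
      rw [this]; exact pow_ne_zero 2 hF
    have hsub : (s.erase 0).image Point.xCoord ⊆ W.Ψ₂Sq.roots.toFinset := by
      intro z hz
      obtain ⟨P, hP, rfl⟩ := Finset.mem_image.mp hz
      rw [Multiset.mem_toFinset, Polynomial.mem_roots (W.Ψ₂Sq_ne_zero h4), Polynomial.IsRoot]
      have hP₀ := Finset.ne_of_mem_erase hP
      have hP₂ := hs P (Finset.mem_of_mem_erase hP)
      rcases P with _ | ⟨x, y, h⟩
      · exact absurd rfl hP₀
      by_contra hne
      rw [Point.xCoord_some, eval_Ψ₂Sq_eq h.1] at hne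
      have hy : y ≠ W.negY x y := by
        intro hy
        apply hne
        rw [negY] at hy
        rw [show 2 * y + W.a₁ * x + W.a₃ = 0 by linear_combination hy]
        simp
      rw [two_nsmul, Point.add_self_of_Y_ne hy] at hP₂
      exact Point.some_ne_zero _ hP₂
    calc #(s.erase 0) = #((s.erase 0).image Point.xCoord) := (card_image_of_injOn hinj).symm
      _ ≤ _ := card_le_card hsub
      _ ≤ _ := Multiset.toFinset_card_le _
      _ ≤ _ := Polynomial.card_roots' _
      _ ≤ _ := W.natDegree_Ψ₂Sq_le
  · have h3 : 3 ≤ ℓ := by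
      have := hℓ.two_le
      rcases hodd with ⟨k, rfl⟩
      omega
    have hne : ¬ Even ℓ := Nat.not_even_iff_odd.mpr hodd
    have hmaps : ∀ P ∈ s.erase 0, P.xCoord ∈ (W.preΨ' ℓ).roots.toFinset := by
      intro P hP
      rw [Multiset.mem_toFinset, Polynomial.mem_roots (W.preΨ'_ne_zero hF), Polynomial.IsRoot]
      have hP₀ := Finset.ne_of_mem_erase hP
      have hP₁ := hs P (Finset.mem_of_mem_erase hP)
      rcases P with _ | ⟨x, y, h⟩
      · exact absurd rfl hP₀
      exact eval_preΨ'_eq_zero h3 hne (horder hP₀ hP₁) hP₁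
    -- At most two points ±Q lie over each root.
    have h₂ := card_le_mul_card_image_of_maps_to hmaps 2 (by
      intro z _
      rcases Finset.eq_empty_or_nonempty {P ∈ s.erase 0 | P.xCoord = z} with h | ⟨Q, hQ⟩
      · simp [h]
      · have hQ' := Finset.mem_filter.mp hQ
        refine (card_le_card (t := {Q, -Q}) fun P hP ↦ ?_).trans card_le_two
        have hP' := Finset.mem_filter.mp hP
        simpa using hfib hP'.1 hQ'.1 (hP'.2.trans hQ'.2.symm))
    have h₄ : #(W.preΨ' ℓ).roots.toFinset ≤ (ℓ ^ 2 - 1) / 2 := by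
      refine (Multiset.toFinset_card_le _).trans ((Polynomial.card_roots' _).trans ?_)
      simpa [hne] using W.natDegree_preΨ'_le ℓ
    omega

end WeierstrassCurve.Affine

/-! ### Torsion and iterates in abelian groups -/

namespace AddCommGroup

variable {A : Type*} [AddCommGroup A]

open Finset in
/-- A bound for the `ℓ`-torsion gives a bound for the `ℓ ^ m`-torsion. -/
lemma card_le_of_pow_nsmul_eq_zero {ℓ c : ℕ}
    (h : ∀ s : Finset A, (∀ a ∈ s, ℓ • a = 0) → #s ≤ c) (m : ℕ) (s : Finset A)
    (hs : ∀ a ∈ s, ℓ ^ m • a = 0) : #s ≤ c ^ m := by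
  classical
  induction m generalizing s with
  | zero =>
    rw [pow_zero]
    refine card_le_one.mpr fun a ha b hb ↦ ?_
    rw [← one_nsmul a, ← one_nsmul b, ← pow_zero ℓ, hs a ha, hs b hb]
  | succ m ih =>
    calc #s ≤ c * #(s.image (ℓ • ·)) := by
          refine card_le_mul_card_image s c fun b hb ↦ ?_
          obtain ⟨a₀, -, rfl⟩ := mem_image.mp hb
          rw [← card_image_of_injective _ (sub_left_injective (b := a₀))]
          refine h _ fun a ha ↦ ?_
          obtain ⟨a', ha', rfl⟩ := mem_image.mp ha
          rw [nsmul_sub, (mem_filter.mp ha').2, sub_self]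
      _ ≤ c * c ^ m := by
          gcongr
          refine ih _ fun a ha ↦ ?_
          obtain ⟨a', ha', rfl⟩ := mem_image.mp ha
          rw [← mul_nsmul', ← pow_succ, hs a' ha']
      _ = c ^ (m + 1) := (pow_succ' c m).symm

/-- Binomial expansion of (1 + δ)^d with δ = g - 1 and δ^3 a = 0. -/
lemma iterate_apply_eq_add_of_fixed {g : A →+ A} {d : ℕ} {a D E : A} (ha : g a = a + D)
    (hD : g D = D + E) (hE : g E = E) (hdE : d.choose 2 • E = 0) :
    g^[d] a = a + d • D := by
  have key (n : ℕ) : g^[n] a = a + n • D + n.choose 2 • E := by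
    induction n with
    | zero => simp
    | succ n ih =>
      rw [Function.iterate_succ_apply', ih, map_add, map_add, map_nsmul, map_nsmul, ha, hD, hE,
        Nat.choose_succ_succ' n 1, Nat.choose_one_right, add_nsmul, add_nsmul, one_nsmul,
        nsmul_add]
      abel
  rw [key, hdE, add_zero]

lemma exists_addMonoidHom_eq_iterate (g : A →+ A) (n : ℕ) :
    ∃ g' : A →+ A, ∀ x, g' x = g^[n] x := by
  induction n with
  | zero => exact ⟨AddMonoidHom.id A, fun _ ↦ rfl⟩
  | succ n ih =>
    obtain ⟨g', hg'⟩ := ih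
    exact ⟨g'.comp g, fun x ↦ hg' (g x)⟩

/-- An endomorphism that is trivial on the `ℓ ^ m`-torsion, where `ℓ ^ m ≥ 3`, has
`ℓ ^ k`-th iterate `a ↦ a + ℓ ^ k • (g a - a)` wherever `g a - a` is killed by `ℓ ^ (k + 1)`. -/
lemma iterate_pow_apply {ℓ m : ℕ} (hℓ : ℓ.Prime) (hm : 0 < m) (hℓm : 3 ≤ ℓ ^ m) {g : A →+ A}
    (hg : ∀ a, ℓ ^ m • a = 0 → g a = a) (k : ℕ) {a : A} (ha : ℓ ^ (k + 1) • (g a - a) = 0) :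
    g^[ℓ ^ k] a = a + ℓ ^ k • (g a - a) := by
  induction k generalizing a with
  | zero => simp
  | succ k ih =>
    obtain ⟨g', hg'⟩ : ∃ g' : A →+ A, ∀ x, g' x = g^[ℓ ^ k] x :=
      
      exists_addMonoidHom_eq_iterate g _
    have hfix {x : A} (hx : ℓ ^ m • x = 0) : g' x = x := by
      rw [hg', Function.iterate_fixed (hg x hx)]
    have h₁ : ℓ • (g' a - a) = ℓ ^ (k + 1) • (g a - a) := by
      have := ih (a := ℓ • a) (by
        rw [map_nsmul, ← nsmul_sub, ← mul_nsmul', ← pow_succ, ha])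
      rw [← hg', map_nsmul, map_nsmul, ← nsmul_sub, ← mul_nsmul', ← pow_succ] at this
      rw [nsmul_sub, this, add_sub_cancel_left]
    have h₂ : ℓ ^ 2 • (g' a - a) = 0 := by
      rw [pow_two, mul_nsmul', h₁, ← mul_nsmul', ← pow_succ', ha]
    have hit : g^[ℓ ^ (k + 1)] a = g'^[ℓ] a := by
      rw [pow_succ, Function.iterate_mul]
      congr 1
      exact (funext hg').symm
    rw [hit, ← h₁]
    -- If m ≥ 2, then g' a - a is ℓ^m-torsion, so the second difference is zero.
    by_cases hm2 : 2 ≤ m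
    · refine iterate_apply_eq_add_of_fixed (E := 0) (by abel) ?_ (map_zero _) (nsmul_zero _)
      rw [add_zero]
      apply hfix
      rw [← Nat.sub_add_cancel hm2, pow_add, mul_nsmul', h₂, nsmul_zero]
    -- Here ℓ ≥ 3, so ℓ divides ℓ.choose 2, which kills the ℓ-torsion second difference.
    · obtain rfl : m = 1 := by omega
      rw [pow_one] at hℓm hfix
      have h₃ : ℓ • (g' (g' a - a) - (g' a - a)) = 0 := by
        rw [nsmul_sub, ← map_nsmul, hfix, sub_self]
        rw [← mul_nsmul', ← pow_two, h₂]
      refine iterate_apply_eq_add_of_fixed (E := g' (g' a - a) - (g' a - a)) (by abel) (by abel)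
        (hfix h₃) ?_
      obtain ⟨c, hc⟩ := hℓ.dvd_choose_self two_ne_zero (by omega)
      rw [hc, mul_nsmul, h₃, nsmul_zero]

end AddCommGroup

/-! ### Galois action and rationality -/

namespace EllTorsion

open WeierstrassCurve

variable {K : Type*} [Field K] {E : WeierstrassCurve K}
variable {Kbar : Type*} [Field Kbar] [Algebra K Kbar] [DecidableEq Kbar]

lemma mem_rationalPoints_iff (F : Type*) [Field F] [Algebra K F] [Algebra F Kbar]
    [IsScalarTower K F Kbar] {P : GeomPoint E Kbar} :
    P ∈ rationalPoints E Kbar F ↔ ∀ x y h, P = Affine.Point.some x y h →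
      x ∈ (algebraMap F Kbar).range ∧ y ∈ (algebraMap F Kbar).range := by
  classical
  constructor
  · rintro ⟨Q, rfl⟩ x y h hQ
    rcases Q with _ | ⟨x', y', h'⟩
    · exact absurd hQ.symm (Affine.Point.some_ne_zero h)
    · rw [Affine.Point.map_some, Affine.Point.some.injEq] at hQ
      exact ⟨⟨x', hQ.1⟩, ⟨y', hQ.2⟩⟩
  · intro hP
    rcases P with _ | ⟨x, y, h⟩
    · exact zero_mem _
    · obtain ⟨⟨x', rfl⟩, ⟨y', rfl⟩⟩ := hP x y h rfl
      exact ⟨.some x' y' ((E.toAffine.baseChange_nonsingular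
        (f := IsScalarTower.toAlgHom K F Kbar) (algebraMap F Kbar).injective x' y').mp h), rfl⟩

/-- The action of an automorphism of `Kbar` on `E(Kbar)`. -/
noncomputable def galoisAction (E : WeierstrassCurve K) (σ : Kbar ≃ₐ[K] Kbar) :
    GeomPoint E Kbar →+ GeomPoint E Kbar :=
  Affine.Point.map (W' := E.toAffine) σ.toAlgHom

lemma galoisAction_some_eq_iff (σ : Kbar ≃ₐ[K] Kbar) {x y : Kbar}
    (h : (E.baseChange Kbar).toAffine.Nonsingular x y) :
    galoisAction E σ (.some x y h) = .some x y h ↔ σ x = x ∧ σ y = y := by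
  rw [galoisAction, Affine.Point.map_some, Affine.Point.some.injEq]
  rfl

lemma galoisAction_pow (σ : Kbar ≃ₐ[K] Kbar) (n : ℕ) (P : GeomPoint E Kbar) :
    galoisAction E (σ ^ n) P = (galoisAction E σ)^[n] P := by
  induction n with
  | zero =>
    rcases P with _ | ⟨x, y, h⟩
    · rfl
    · exact (galoisAction_some_eq_iff _ h).mpr ⟨rfl, rfl⟩
  | succ n ih =>
    rw [Function.iterate_succ_apply', ← ih, pow_succ', galoisAction, galoisAction, galoisAction,
      Affine.Point.map_map]
    rfl

lemma galoisAction_eq_self_of_mem {F : IntermediateField K Kbar} {σ : Kbar ≃ₐ[K] Kbar}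
    (hσ : ∀ z ∈ F, σ z = z) {P : GeomPoint E Kbar} (hP : P ∈ rationalPoints E Kbar F) :
    galoisAction E σ P = P := by
  rw [mem_rationalPoints_iff] at hP
  rcases P with _ | ⟨x, y, h⟩
  · exact map_zero _
  · obtain ⟨⟨x', hx⟩, ⟨y', hy⟩⟩ := hP x y h rfl
    exact (galoisAction_some_eq_iff σ h).mpr
      ⟨hσ x (hx ▸ x'.2), hσ y (hy ▸ y'.2)⟩

lemma mem_rationalPoints_iff_galoisAction [IsGalois K Kbar] {P : GeomPoint E Kbar} :
    P ∈ rationalPoints E Kbar K ↔ ∀ σ : Kbar ≃ₐ[K] Kbar, galoisAction E σ P = P := by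
  rw [mem_rationalPoints_iff]
  rcases P with _ | ⟨x, y, h⟩
  · exact ⟨fun _ σ ↦ map_zero _, fun _ x y h hP ↦ absurd hP.symm (Affine.Point.some_ne_zero h)⟩
  · simp only [galoisAction_some_eq_iff]
    constructor
    · intro hP σ
      obtain ⟨⟨x', rfl⟩, ⟨y', rfl⟩⟩ := hP x y h rfl
      exact ⟨σ.commutes x', σ.commutes y'⟩
    · rintro hσ x' y' h' hP
      rw [Affine.Point.some.injEq] at hP
      obtain ⟨rfl, rfl⟩ := hP
      exact ⟨(InfiniteGalois.mem_range_algebraMap_iff_fixed x).mpr fun σ ↦ (hσ σ).1,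
        (InfiniteGalois.mem_range_algebraMap_iff_fixed y).mpr fun σ ↦ (hσ σ).2⟩

/-- Points of `S` are rational over the field of definition of `S`. -/
lemma mem_rationalPoints_fieldOfDefinition {S : Set (GeomPoint E Kbar)} {P : GeomPoint E Kbar}
    (hP : P ∈ S) : P ∈ rationalPoints E Kbar (fieldOfDefinition S) := by
  rw [mem_rationalPoints_iff]
  rintro x y h rfl
  exact ⟨⟨⟨x, IntermediateField.subset_adjoin _ _ ⟨x, y, h, hP, .inl rfl⟩⟩, rfl⟩,
    ⟨⟨y, IntermediateField.subset_adjoin _ _ ⟨x, y, h, hP, .inr rfl⟩⟩, rfl⟩⟩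

/-- An automorphism fixing the points of `S` fixes the field of definition of `S`. -/
lemma fixes_fieldOfDefinition {S : Set (GeomPoint E Kbar)} {σ : Kbar ≃ₐ[K] Kbar}
    (hσ : ∀ P ∈ S, galoisAction E σ P = P) : ∀ z ∈ fieldOfDefinition S, σ z = z := by
  intro z hz
  induction hz using IntermediateField.adjoin_induction with
  | mem z hz =>
    obtain ⟨x, y, h, hP, rfl | rfl⟩ := hz
    · exact ((galoisAction_some_eq_iff σ h).mp (hσ _ hP)).1
    · exact ((galoisAction_some_eq_iff σ h).mp (hσ _ hP)).2
  | algebraMap x => exact σ.commutes x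
  | add x y _ _ hx hy => rw [map_add, hx, hy]
  | inv x _ hx => rw [map_inv₀, hx]
  | mul x y _ _ hx hy => rw [map_mul, hx, hy]

/-- A subgroup of `E(Kbar)` isomorphic to `(ℤ/ℓ^m)²` contains the whole `ℓ ^ m`-torsion. -/
lemma mem_of_pow_nsmul_eq_zero [CharZero Kbar] {ℓ m : ℕ} (hℓ : ℓ.Prime)
    {H : AddSubgroup (GeomPoint E Kbar)} (e : H ≃+ ZMod (ℓ ^ m) × ZMod (ℓ ^ m))
    {P : GeomPoint E Kbar} (hP : ℓ ^ m • P = 0) : P ∈ H := by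
  classical
  have : NeZero (ℓ ^ m) := ⟨pow_ne_zero m hℓ.ne_zero⟩
  have : Finite H := Finite.of_equiv _ e.symm.toEquiv
  have hfin : (H : Set (GeomPoint E Kbar)).Finite := Set.toFinite _
  have hcard : hfin.toFinset.card = (ℓ ^ 2) ^ m := by
    rw [← Set.ncard_eq_toFinset_card _ hfin, ← Nat.card_coe_set_eq]
    refine (Nat.card_congr e.toEquiv).trans ?_
    rw [Nat.card_prod, Nat.card_zmod]
    ring
  -- Adjoining P to H would exceed the bound ℓ^(2m).
  by_contra hPH
  have h := AddCommGroup.card_le_of_pow_nsmul_eq_zero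
    (Affine.card_le_of_prime_nsmul_eq_zero (W := (E.baseChange Kbar).toAffine) hℓ
      (Nat.cast_ne_zero.mpr hℓ.ne_zero)) m (insert P hfin.toFinset) (by
      intro Q hQ
      rcases Finset.mem_insert.mp hQ with rfl | hQ
      · exact hP
      · have hQH : Q ∈ H := hfin.mem_toFinset.mp hQ
        have : ℓ ^ m • (⟨Q, hQH⟩ : H) = 0 := by
          apply e.injective
          rw [map_nsmul, map_zero]
          rw [nsmul_eq_mul, show ((ℓ ^ m : ℕ) : ZMod (ℓ ^ m) × ZMod (ℓ ^ m)) = 0 from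
            Prod.ext (ZMod.natCast_self _) (ZMod.natCast_self _), zero_mul]
        exact congrArg Subtype.val this)
  rw [Finset.card_insert_of_notMem (by simpa using hPH), hcard] at h
  omega

end EllTorsion

theorem theorem1p3 {K : Type*} [Field K] [CharZero K]
    (Kbar : Type*) [Field Kbar] [Algebra K Kbar] [IsAlgClosure K Kbar] [DecidableEq Kbar]
    (E : WeierstrassCurve K) [E.IsElliptic]
    (ℓ : ℕ) [Fact ℓ.Prime] (m : ℕ) (hm : 0 < m) (hℓm : 3 ≤ ℓ ^ m)
    (hE : ∃ H : AddSubgroup (EllTorsion.GeomPoint E Kbar),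
      H ≤ EllTorsion.rationalPoints E Kbar K ∧
        Nonempty (H ≃+ ZMod (ℓ ^ m) × ZMod (ℓ ^ m)))
    (k : ℕ) :
    EllTorsion.rationalPrimary E Kbar ℓ
        (EllTorsion.fieldOfDefinition
          (EllTorsion.divisionSubgroup E Kbar ℓ k : Set (EllTorsion.GeomPoint E Kbar))) =
      EllTorsion.divisionSubgroup E Kbar ℓ k := by
  have hℓ : ℓ.Prime := Fact.out
  have : CharZero Kbar := charZero_of_injective_algebraMap (algebraMap K Kbar).injective
  have : IsGalois K Kbar := inferInstance
  obtain ⟨H, hH, ⟨e⟩⟩ := hE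
  have htors (σ : Kbar ≃ₐ[K] Kbar) (P : EllTorsion.GeomPoint E Kbar) (hP : ℓ ^ m • P = 0) :
      EllTorsion.galoisAction E σ P = P :=
    EllTorsion.mem_rationalPoints_iff_galoisAction.mp
      (hH (EllTorsion.mem_of_pow_nsmul_eq_zero hℓ e hP)) σ
  refine le_antisymm ?_ fun P hP ↦
    ⟨EllTorsion.mem_rationalPoints_fieldOfDefinition hP, hP.1⟩
  rintro P ⟨hPrat, hPprim⟩
  refine ⟨hPprim, ?_⟩
  change ℓ ^ k • P ∈ EllTorsion.rationalPoints E Kbar K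
  have step {Q : EllTorsion.GeomPoint E Kbar}
      (hQ : Q ∈ EllTorsion.rationalPoints E Kbar (EllTorsion.fieldOfDefinition
        (EllTorsion.divisionSubgroup E Kbar ℓ k : Set (EllTorsion.GeomPoint E Kbar))))
      (hQ' : ℓ ^ (k + 1) • Q ∈ EllTorsion.rationalPoints E Kbar K) :
      ℓ ^ k • Q ∈ EllTorsion.rationalPoints E Kbar K := by
    rw [EllTorsion.mem_rationalPoints_iff_galoisAction] at hQ' ⊢
    intro σ
    have hpow {R : EllTorsion.GeomPoint E Kbar}
        (hR : ℓ ^ (k + 1) • (EllTorsion.galoisAction E σ R - R) = 0) :=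
      AddCommGroup.iterate_pow_apply hℓ hm hℓm (htors σ) k hR
    have hfix : ∀ R ∈ (EllTorsion.divisionSubgroup E Kbar ℓ k : Set _),
        EllTorsion.galoisAction E (σ ^ ℓ ^ k) R = R := by
      intro R hR
      have hR' : ℓ ^ k • (EllTorsion.galoisAction E σ R - R) = 0 := by
        have hRK : ℓ ^ k • R ∈ EllTorsion.rationalPoints E Kbar K := hR.2
        rw [nsmul_sub, ← map_nsmul,
          EllTorsion.mem_rationalPoints_iff_galoisAction.mp hRK σ, sub_self]
      rw [EllTorsion.galoisAction_pow, hpow (by rw [pow_succ', mul_nsmul', hR', nsmul_zero]),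
        hR', add_zero]
    have hQσ := EllTorsion.galoisAction_eq_self_of_mem
      (EllTorsion.fixes_fieldOfDefinition hfix) hQ
    rw [EllTorsion.galoisAction_pow, hpow (by rw [nsmul_sub, ← map_nsmul, hQ' σ, sub_self]),
      add_eq_left, nsmul_sub, sub_eq_zero] at hQσ
    rw [map_nsmul, hQσ]
  -- `step`, applied to multiples ℓ^i P, removes one factor ℓ at a time from ℓ^(k+n) P.
  obtain ⟨n, hn⟩ := hPprim
  have hn' : ℓ ^ (k + n) • P ∈ EllTorsion.rationalPoints E Kbar K := by
    rw [pow_add, mul_nsmul', hn, nsmul_zero]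
    exact zero_mem _
  clear hn
  induction n with
  | zero => exact hn'
  | succ n ih =>
    apply ih
    rw [pow_add, mul_nsmul']
    apply step (nsmul_mem hPrat _)
    rw [← mul_nsmul', ← pow_add, show k + 1 + n = k + (n + 1) by omega]
    exact hn'
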